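/- \textbf{Theorem.} A \emph{tripartite hypergraph} on $n+n+n$ vertices consists of three pairwise disjoint vertex classes $V_1,V_2,V_3$ of $n$ vertices each, together with a set $E$ of subsets of $V_1\cup V_2\cup V_3$ (the hyperedges), such that $|e\cap V_k|=1$ for every $e\in E$ and every $k\in\{1,2,3\}$. The degree of a vertex is the number of hyperedges that contain it. Let $n$ be a non-negative integer and let $D=(D_1,D_2,D_3)$ with $D_k=(d_{k,1},\dots,d_{k,n})$ be three sequences of non-negative integers such that $$\sum_{i=1}^n d_{1,i}=\sum_{i=1}^n d_{2,i}=\sum_{i=1}^n d_{3,i}$$ and $$\frac{2n^2}{7}\le d_{k,i}\le \frac{5n^2}{7}\qquad\text{for all } k\in\{1,2,3\},\ i\in\{1,\dots,n\}.$$ Then $D$ is graphic: there is a tripartite hypergraph on vertex classes $V_k=\{v_{k,1},\dots,v_{k,n}\}$ $(k=1,2,3)$ in which the vertex $v_{k,i}$ has degree exactly $d_{k,i}$ for all $k$ and $i$. -/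

import Mathlib

/-- The degree of a vertex: the number of hyperedges incident with it. -/
noncomputable def Hypergraph.degree {V : Type*} (H : Hypergraph V) (v : V) : ℕ :=
  {e : Set V | e ∈ H.edgeSet ∧ v ∈ e}.ncard

/-- The vertices of a tripartite hypergraph on `N 0 + N 1 + N 2` vertices: the disjoint union of
three vertex classes, the class with index `k` having `N k` vertices. -/
abbrev TripartiteVertex (N : Fin 3 → ℕ) : Type := Σ k : Fin 3, Fin (N k)

/-- The vertex class with index `k`. -/
def vertexClass (N : Fin 3 → ℕ) (k : Fin 3) : Set (TripartiteVertex N) :=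
  {v | v.1 = k}

/-- `H` is a tripartite hypergraph (a partite `3`-uniform hypergraph) on the three given vertex
classes: its vertex set is their union, and each hyperedge has exactly one vertex in each class. -/
def IsTripartite {N : Fin 3 → ℕ} (H : Hypergraph (TripartiteVertex N)) : Prop :=
  H.vertexSet = Set.univ ∧
    ∀ e ∈ H.edgeSet, ∀ k : Fin 3, (e ∩ vertexClass N k).ncard = 1

/-- `H` is a realization of the tripartite degree sequence `D`, where `D k i` is the prescribed
degree of the vertex with index `i` in the class with index `k`. -/
def IsTripartiteRealization {N : Fin 3 → ℕ} (H : Hypergraph (TripartiteVertex N))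
    (D : (k : Fin 3) → Fin (N k) → ℕ) : Prop :=
  IsTripartite H ∧ ∀ (k : Fin 3) (i : Fin (N k)), H.degree ⟨k, i⟩ = D k i

/-- A tripartite degree sequence is graphic if it has a tripartite realization. -/
def IsTripartiteGraphic {N : Fin 3 → ℕ} (D : (k : Fin 3) → Fin (N k) → ℕ) : Prop :=
  ∃ H : Hypergraph (TripartiteVertex N), IsTripartiteRealization H D

/-!
A tripartite hypergraph on `n + n + n` vertices is encoded as a finite set `E` of triples
`Fin 3 → Fin n`, and `coordDegree E k i` is the degree of the vertex `i` of the class `k`. Let `hi`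
be the integer part of `5 n² / 7` and `lo = n² - hi`, so that all prescribed degrees lie between
`lo` and `hi`.

*Majorization.* If `u` and `v` belong to the same class and `u` has larger degree than `v`, some
hyperedge at `u` can be moved to `v` without changing the degrees in the other classes
(`exists_move`). Hence, whenever the degree sequence of `E` in a class majorizes a sequence `D`, that
class can be given the degrees `D`, the other two being left alone (`exists_coordDegree_eq`). Among
the sequences of a given sum with values in `[lo, hi]`, the most spread out one has the value `hi`
on a set `P` and `lo` on a set `Q`, where `P` and `Q` together miss one vertex. So it is enough to
find a single `E` of the correct size which, in each class, has at least `|P| hi` incidences with `P`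
and at most `|Q| lo` incidences with `Q` (`sum_tsub_le_of_cuts`).

*Construction.* Passing to complements, the condition on `Q` says that the complement of `E` has at
least `|Q| hi` incidences with `Q` in each class. It therefore suffices to find disjoint families `A`
and `C`, neither too large, such that `A` is rich in incidences with `P` and `C` with `Q`
(`exists_disjoint_isRich`); any `E` of the correct size between `A` and the complement of `C` will
do. An incidence is cheapest in a triple with many coordinates in `P`, so `A` consists of triples with
three or two coordinates in `P`, supplemented evenly in the three classes by triples with a single
one if need be, and likewise for `C`. That the families are small enough and can be kept disjoint
comes down to cubic inequalities in `|P|` and `|Q|`.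
-/

/-! ### Coordinate degrees -/

/-- The number of tuples in `E` whose coordinate with index `k` equals `i`. Tuples `Fin 3 → Fin n`
encode the possible hyperedges of a tripartite hypergraph, and this is the degree of the vertex
`i` in the class `k`. -/
def coordDegree {κ α : Type*} [DecidableEq α] (E : Finset (κ → α)) (k : κ) (i : α) : ℕ :=
  (E.filter fun e => e k = i).card

section Transfer

variable {κ α : Type*}

lemma sum_coordDegree [DecidableEq α] (E : Finset (κ → α)) (k : κ) (S : Finset α) :
    ∑ i ∈ S, coordDegree E k i = (E.filter fun e => e k ∈ S).card := by
  rw [Finset.card_eq_sum_card_fiberwise (f := fun e => e k) (t := S)]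
  · refine Finset.sum_congr rfl fun i hi => ?_
    rw [coordDegree, Finset.filter_filter]
    congr 1
    ext e
    simp only [Finset.mem_filter]
    constructor
    · rintro ⟨h1, rfl⟩; exact ⟨h1, hi, rfl⟩
    · rintro ⟨h1, -, h2⟩; exact ⟨h1, h2⟩
  · intro e he
    simp only [Finset.coe_filter, Set.mem_ofPred_eq] at he
    exact he.2

lemma sum_univ_coordDegree [Fintype α] [DecidableEq α] (E : Finset (κ → α)) (k : κ) :
    ∑ i, coordDegree E k i = E.card := by
  rw [sum_coordDegree]
  simp

lemma coordDegree_insert [Fintype κ] [DecidableEq κ] [DecidableEq α] {E : Finset (κ → α)}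
    {e : κ → α} (he : e ∉ E) (k : κ) (i : α) :
    coordDegree (insert e E) k i = coordDegree E k i + if e k = i then 1 else 0 := by
  unfold coordDegree
  rw [Finset.filter_insert]
  split_ifs with h
  · rw [Finset.card_insert_of_notMem (by simp [he])]
  · rfl

/-- Replacing a tuple `e` by `Function.update e k v` moves one unit of degree from `e k` to `v` in
the class `k` and leaves all degrees in the other classes alone. If `u` has larger degree than `v`,
then some tuple at `u` can be so replaced. -/
lemma exists_move [Fintype κ] [DecidableEq κ] [DecidableEq α] {E : Finset (κ → α)} {k : κ} {u v : α}
    (h : coordDegree E k v < coordDegree E k u) :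
    ∃ E' : Finset (κ → α), coordDegree E' k u + 1 = coordDegree E k u ∧
      coordDegree E' k v = coordDegree E k v + 1 ∧
      (∀ w, w ≠ u → w ≠ v → coordDegree E' k w = coordDegree E k w) ∧
      ∀ l, l ≠ k → ∀ i, coordDegree E' l i = coordDegree E l i := by
  have huv : u ≠ v := by rintro rfl; exact lt_irrefl _ h
  obtain ⟨e, he, heu, hv⟩ : ∃ e ∈ E, e k = u ∧ Function.update e k v ∉ E := by
    by_contra! hcon
    refine absurd h (not_lt.2 ?_)
    refine Finset.card_le_card_of_injOn (fun e => Function.update e k v) ?_ ?_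
    · intro e he
      simp only [Finset.coe_filter, Set.mem_ofPred_eq] at he ⊢
      exact ⟨hcon e he.1 he.2, by simp⟩
    · intro e he e' he' hee
      simp only [Finset.coe_filter, Set.mem_ofPred_eq] at he he'
      funext l
      by_cases hl : l = k
      · rw [hl, he.2, he'.2]
      · simpa [hl] using congrFun hee l
  have hv' : Function.update e k v ∉ E.erase e := fun h => hv (Finset.mem_of_mem_erase h)
  have hE (l : κ) (i : α) := coordDegree_insert (Finset.notMem_erase e E) l i
  have hE' (l : κ) (i : α) := coordDegree_insert hv' l i
  simp only [Finset.insert_erase he] at hE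
  refine ⟨insert (Function.update e k v) (E.erase e), ?_, ?_, ?_, ?_⟩
  · rw [hE', hE k u]; simp [heu, huv.symm]
  · rw [hE', hE k v]; simp [heu, huv]
  · intro w hwu hwv
    rw [hE', hE k w]; simp [heu, hwu.symm, hwv.symm]
  · intro l hl i
    rw [hE', hE l i]; simp [hl]

/-! ### Majorization and unit transfers -/

lemma sum_tsub_eq_add_card [Fintype α] (f : α → ℕ) (c : ℕ) :
    ∑ i, (f i - c) = ∑ i, (f i - (c + 1)) + (Finset.univ.filter fun i => c < f i).card := by
  rw [Finset.card_filter, ← Finset.sum_add_distrib]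
  refine Finset.sum_congr rfl fun i _ => ?_
  split_ifs <;> omega

lemma card_lt_eq_add_card [Fintype α] (f : α → ℕ) (c : ℕ) :
    (Finset.univ.filter fun i => c < f i).card =
      (Finset.univ.filter fun i => c + 1 < f i).card +
        (Finset.univ.filter fun i => f i = c + 1).card := by
  simp only [Finset.card_filter]
  rw [← Finset.sum_add_distrib]
  refine Finset.sum_congr rfl fun i _ => ?_
  split_ifs <;> omega

lemma card_eq_card_pos_add_card_zero [Fintype α] (f : α → ℕ) :
    Fintype.card α = (Finset.univ.filter fun i => 0 < f i).card +
      (Finset.univ.filter fun i => f i = 0).card := by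
  simp only [Finset.card_filter, Fintype.card_eq_sum_ones]
  rw [← Finset.sum_add_distrib]
  refine Finset.sum_congr rfl fun i _ => ?_
  split_ifs <;> omega

lemma sum_add_eq_sum_add_of_eq_off_pair [Fintype α] [DecidableEq α] {f g : α → ℕ} {u v : α}
    (huv : u ≠ v)
    (h : ∀ w, w ≠ u → w ≠ v → f w = g w) :
    ∑ i, f i + (g u + g v) = ∑ i, g i + (f u + f v) := by
  have hv : v ∈ Finset.univ.erase u := by simp [huv.symm]
  have hsum (F : α → ℕ) := Finset.add_sum_erase Finset.univ F (Finset.mem_univ u)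
  have hsum' (F : α → ℕ) := Finset.add_sum_erase (Finset.univ.erase u) F hv
  have hrest : ∑ i ∈ (Finset.univ.erase u).erase v, f i =
      ∑ i ∈ (Finset.univ.erase u).erase v, g i := by
    refine Finset.sum_congr rfl fun w hw => ?_
    simp only [Finset.mem_erase] at hw
    exact h w hw.2.1 hw.1
  have h1 := hsum f
  have h2 := hsum g
  have h3 := hsum' f
  have h4 := hsum' g
  omega

/-- Two integer functions with the same tail sums take each value equally often, hence differ by a
permutation of the domain. -/
lemma exists_perm_of_sum_tsub_eq [Fintype α] {f g : α → ℕ}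
    (h : ∀ c, ∑ i, (f i - c) = ∑ i, (g i - c)) : ∃ σ : Equiv.Perm α, ∀ i, g (σ i) = f i := by
  have hlt (c : ℕ) : (Finset.univ.filter fun i => c < f i).card =
      (Finset.univ.filter fun i => c < g i).card := by
    have h1 := sum_tsub_eq_add_card f c
    have h2 := sum_tsub_eq_add_card g c
    have h3 := h c
    have h4 := h (c + 1)
    omega
  have heq (c : ℕ) : (Finset.univ.filter fun i => f i = c).card =
      (Finset.univ.filter fun i => g i = c).card := by
    cases c with
    | zero =>
      have h1 := card_eq_card_pos_add_card_zero f
      have h2 := card_eq_card_pos_add_card_zero g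
      have h3 := hlt 0
      omega
    | succ c =>
      have h1 := card_lt_eq_add_card f c
      have h2 := card_lt_eq_add_card g c
      have h3 := hlt c
      have h4 := hlt (c + 1)
      omega
  have e (c : ℕ) : {i // f i = c} ≃ {i // g i = c} :=
    Fintype.equivOfCardEq (by rw [Fintype.card_subtype, Fintype.card_subtype, heq])
  exact ⟨Equiv.ofFiberEquiv e, Equiv.ofFiberEquiv_map e⟩

/-- If `d` strictly majorizes `D`, there are a low value `d v` and a high value `d u` such that
majorization is strict at every threshold strictly between them, so that a unit may be moved from
`u` to `v`. The thresholds are the ends of a maximal interval of strictness. -/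
lemma exists_strict_interval [Fintype α] {d D : α → ℕ} (hsum : ∑ i, D i = ∑ i, d i)
    (hmaj : ∀ c, ∑ i, (D i - c) ≤ ∑ i, (d i - c)) {c : ℕ}
    (hc : ∑ i, (D i - c) < ∑ i, (d i - c)) :
    ∃ u v, d v + 2 ≤ d u ∧
      ∀ t, d v < t → t < d u → ∑ i, (D i - t) < ∑ i, (d i - t) := by
  classical
  have hex : ∃ c, ∑ i, (D i - c) < ∑ i, (d i - c) := ⟨c, hc⟩
  obtain ⟨a, ha⟩ : ∃ a, Nat.find hex = a + 1 := by
    refine Nat.exists_eq_succ_of_ne_zero fun h0 => ?_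
    have := Nat.find_spec hex
    rw [h0] at this
    simp only [tsub_zero] at this
    omega
  have hlow : ∑ i, (D i - (a + 1)) < ∑ i, (d i - (a + 1)) := ha ▸ Nat.find_spec hex
  have hbelow (t : ℕ) (ht : t ≤ a) : ∑ i, (D i - t) = ∑ i, (d i - t) :=
    le_antisymm (hmaj t) (not_lt.1 (Nat.find_min hex (by omega)))
  -- Beyond the maximum of `d` both tail sums vanish, so strictness ends somewhere.
  have hex' : ∃ b, a + 1 < b ∧ ∑ i, (D i - b) = ∑ i, (d i - b) := by
    refine ⟨a + 2 + ∑ i, d i, by omega, le_antisymm (hmaj _) ?_⟩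
    have : ∑ i, (d i - (a + 2 + ∑ i, d i)) = 0 := by
      refine Finset.sum_eq_zero fun i _ => ?_
      have := Finset.single_le_sum (f := d) (fun _ _ => Nat.zero_le _) (Finset.mem_univ i)
      omega
    omega
  obtain ⟨b, hb⟩ : ∃ b, Nat.find hex' = b + 1 :=
    Nat.exists_eq_succ_of_ne_zero (by have := (Nat.find_spec hex').1; omega)
  have hb1 : a + 1 < b + 1 := hb ▸ (Nat.find_spec hex').1
  have hb2 : ∑ i, (D i - (b + 1)) = ∑ i, (d i - (b + 1)) := hb ▸ (Nat.find_spec hex').2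
  have hbet (t : ℕ) (h1 : a < t) (h2 : t < b + 1) : ∑ i, (D i - t) < ∑ i, (d i - t) := by
    rcases Nat.lt_or_ge (a + 1) t with h3 | h3
    · refine lt_of_le_of_ne (hmaj t) fun h4 => ?_
      exact Nat.find_min hex' (hb ▸ h2) ⟨h3, h4⟩
    · obtain rfl : t = a + 1 := by omega
      exact hlow
  obtain ⟨v, hv⟩ : ∃ v, d v = a := by
    suffices h : 0 < (Finset.univ.filter fun i => d i = a).card by
      obtain ⟨v, hv⟩ := Finset.card_pos.1 h
      exact ⟨v, (Finset.mem_filter.1 hv).2⟩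
    have h1 := sum_tsub_eq_add_card d a
    have h2 := sum_tsub_eq_add_card D a
    have h3 := hbelow a le_rfl
    cases a with
    | zero =>
      have h4 := card_eq_card_pos_add_card_zero d
      have h5 := card_eq_card_pos_add_card_zero D
      omega
    | succ a =>
      have h4 := sum_tsub_eq_add_card d a
      have h5 := sum_tsub_eq_add_card D a
      have h6 := hbelow a (by omega)
      have h7 := card_lt_eq_add_card d a
      have h8 := card_lt_eq_add_card D a
      omega
  obtain ⟨u, hu⟩ : ∃ u, d u = b + 1 := by
    suffices h : 0 < (Finset.univ.filter fun i => d i = b + 1).card by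
      obtain ⟨u, hu⟩ := Finset.card_pos.1 h
      exact ⟨u, (Finset.mem_filter.1 hu).2⟩
    have h1 := sum_tsub_eq_add_card d b
    have h2 := sum_tsub_eq_add_card D b
    have h3 := hbet b (by omega) (by omega)
    have h4 := sum_tsub_eq_add_card d (b + 1)
    have h5 := sum_tsub_eq_add_card D (b + 1)
    have h6 := hmaj (b + 1 + 1)
    have h7 := card_lt_eq_add_card d b
    have h8 := card_lt_eq_add_card D b
    omega
  refine ⟨u, v, by omega, fun t h1 h2 => hbet t (by omega) (by omega)⟩

lemma coordDegree_map_perm [DecidableEq κ] [DecidableEq α] (E : Finset (κ → α)) (k : κ)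
    (σ : Equiv.Perm α) :
    ∃ E' : Finset (κ → α), (∀ i, coordDegree E' k (σ i) = coordDegree E k i) ∧
      ∀ l, l ≠ k → ∀ i, coordDegree E' l i = coordDegree E l i := by
  have hinj : Function.Injective fun e : κ → α => Function.update e k (σ (e k)) := by
    intro e e' h
    funext l
    by_cases hl : l = k
    · subst hl
      simpa using congrFun h l
    · simpa [hl] using congrFun h l
  refine ⟨E.map ⟨_, hinj⟩, fun i => ?_, fun l hl i => ?_⟩
  · simp [coordDegree, Finset.filter_map]
  · simp [coordDegree, Finset.filter_map, hl]

/-- If the degree sequence of `E` in the class `k` majorizes `D` (in the form of tail sums over all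
integer thresholds, subtraction being truncated), then `E` can be changed so as to have degree
sequence `D` in the class `k` and unchanged degrees in the other classes. -/
theorem exists_coordDegree_eq [Fintype κ] [DecidableEq κ] [Fintype α]
    [DecidableEq α] (E : Finset (κ → α)) (k : κ) (D : α → ℕ)
    (hsum : ∑ i, D i = ∑ i, coordDegree E k i)
    (hmaj : ∀ c, ∑ i, (D i - c) ≤ ∑ i, (coordDegree E k i - c)) :
    ∃ E' : Finset (κ → α), (∀ i, coordDegree E' k i = D i) ∧
      ∀ l, l ≠ k → ∀ i, coordDegree E' l i = coordDegree E l i := by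
  -- A transfer from a vertex to one of smaller degree lowers the sum of the squared degrees.
  induction hm : ∑ i, coordDegree E k i ^ 2 using Nat.strong_induction_on generalizing E with
  | _ m ih =>
  by_cases hstrict : ∃ c, ∑ i, (D i - c) < ∑ i, (coordDegree E k i - c)
  · obtain ⟨c, hc⟩ := hstrict
    obtain ⟨u, v, huv, hbet⟩ := exists_strict_interval hsum hmaj hc
    have hne : u ≠ v := by rintro rfl; omega
    obtain ⟨E', hu, hv, hw, hl⟩ := exists_move (E := E) (k := k) (u := u) (v := v) (by omega)
    obtain ⟨E'', h1, h2⟩ := ih (∑ i, coordDegree E' k i ^ 2) (by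
        have h := sum_add_eq_sum_add_of_eq_off_pair (f := fun i => coordDegree E' k i ^ 2)
          (g := fun i => coordDegree E k i ^ 2) hne (fun w h1 h2 => by simp only [hw w h1 h2])
        rw [hv, ← hu] at h
        rw [← hm]
        nlinarith) E' (by
        have h := sum_add_eq_sum_add_of_eq_off_pair (f := fun i => coordDegree E' k i)
          (g := fun i => coordDegree E k i) hne hw
        omega) (fun t => by
        have h := sum_add_eq_sum_add_of_eq_off_pair (f := fun i => coordDegree E' k i - t)
          (g := fun i => coordDegree E k i - t) hne (fun w h1 h2 => by simp only [hw w h1 h2])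
        have h3 := hmaj t
        by_cases ht : coordDegree E k v < t ∧ t < coordDegree E k u
        · have h4 := hbet t ht.1 ht.2
          omega
        · omega) rfl
    exact ⟨E'', h1, fun l hlk i => (h2 l hlk i).trans (hl l hlk i)⟩
  · push Not at hstrict
    obtain ⟨σ, hσ⟩ := exists_perm_of_sum_tsub_eq (f := fun i => coordDegree E k i) (g := D)
      fun c => le_antisymm (hstrict c) (hmaj c)
    obtain ⟨E', h1, h2⟩ := coordDegree_map_perm E k σ
    refine ⟨E', fun i => ?_, h2⟩
    have h3 := h1 (σ.symm i)
    have h4 := hσ (σ.symm i)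
    rw [Equiv.apply_symm_apply] at h3 h4
    rw [h3, h4]

end Transfer

/-- A sequence `D` with values in `[δ, Δ]` is majorized by every sequence `d` of the same sum that
has sum at least `|P| Δ` on a set `P` and at most `|Q| δ` on a set `Q`, where `P` and `Q` together
miss a single point: `D` is extreme when it takes the values `Δ` and `δ` at all points but one. -/
lemma sum_tsub_le_of_cuts {α : Type*} [Fintype α] [DecidableEq α] {d D : α → ℕ} {P Q : Finset α}
    {lo hi : ℕ} (hcard : P.card + Q.card + 1 = Fintype.card α)
    (hsum : ∑ i, D i = ∑ i, d i) (hlo : ∀ i, lo ≤ D i) (hhi : ∀ i, D i ≤ hi)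
    (hP : P.card * hi ≤ ∑ i ∈ P, d i) (hQ : ∑ i ∈ Q, d i ≤ Q.card * lo) (c : ℕ) :
    ∑ i, (D i - c) ≤ ∑ i, (d i - c) := by
  have hcut (S : Finset α) : ∑ i ∈ S, d i ≤ ∑ i, (d i - c) + S.card * c := by
    calc ∑ i ∈ S, d i ≤ ∑ i ∈ S, ((d i - c) + c) := Finset.sum_le_sum fun i _ => by omega
      _ = ∑ i ∈ S, (d i - c) + S.card * c := by
        rw [Finset.sum_add_distrib, Finset.sum_const, smul_eq_mul]
      _ ≤ _ := by
        gcongr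
        exact Finset.subset_univ S
  rcases lt_or_ge c lo with hc | hc
  · have h1 : ∑ i, D i = ∑ i, (D i - c) + Fintype.card α * c := by
      rw [← Finset.card_univ, ← smul_eq_mul, ← Finset.sum_const, ← Finset.sum_add_distrib]
      refine Finset.sum_congr rfl fun i _ => ?_
      have := hlo i
      omega
    have h2 := hcut Finset.univ
    rw [Finset.card_univ] at h2
    omega
  set S := Finset.univ.filter fun i => c < D i with hS
  have hDS : ∑ i, (D i - c) = ∑ i ∈ S, (D i - c) := by
    refine (Finset.sum_subset (Finset.subset_univ S) fun i _ hi => ?_).symm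
    simp only [hS, Finset.mem_filter, Finset.mem_univ, true_and] at hi
    omega
  rcases le_or_gt S.card P.card with hs | hs
  · rcases le_or_gt hi c with hc' | hc'
    · have : ∑ i, (D i - c) = 0 := Finset.sum_eq_zero fun i _ => by have := hhi i; omega
      omega
    have h1 : ∑ i ∈ S, (D i - c) ≤ S.card * (hi - c) := by
      rw [← smul_eq_mul]
      exact Finset.sum_le_card_nsmul _ _ _ fun i _ => by have := hhi i; omega
    have h2 : S.card * (hi - c) ≤ P.card * (hi - c) := Nat.mul_le_mul_right _ hs
    have h3 := hcut P
    have h4 : P.card * (hi - c) + P.card * c = P.card * hi := by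
      rw [← mul_add, Nat.sub_add_cancel hc'.le]
    omega
  · have h1 : ∑ i ∈ S, (D i - c) + S.card * c = ∑ i ∈ S, D i := by
      rw [← smul_eq_mul, ← Finset.sum_const, ← Finset.sum_add_distrib]
      refine Finset.sum_congr rfl fun i hi => ?_
      simp only [hS, Finset.mem_filter] at hi
      omega
    have h2 := Finset.sum_add_sum_compl S D
    have h3 : Sᶜ.card * lo ≤ ∑ i ∈ Sᶜ, D i := by
      rw [← smul_eq_mul]
      exact Finset.card_nsmul_le_sum _ _ _ fun i _ => hlo i
    have h4 := Finset.sum_add_sum_compl Q d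
    have h5 := hcut Qᶜ
    have h6 := Finset.card_add_card_compl S
    have h7 := Finset.card_add_card_compl Q
    obtain ⟨r, hr⟩ := Nat.exists_eq_add_of_lt hs
    have h8 : Q.card = Sᶜ.card + r := by omega
    have h9 : Qᶜ.card = P.card + 1 := by omega
    rw [h8] at hQ
    rw [h9] at h5
    rw [hr] at h1
    nlinarith [Nat.mul_le_mul_left r hc]

/-! ### Layers of triples over a set of vertices -/

section Layers

variable {α : Type*}

/-- The triples whose coordinate with index `k` lies in `S` and whose other two coordinates lie
in `T`. -/
def tripleBox (k : Fin 3) (S T : Finset α) : Finset (Fin 3 → α) :=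
  Fintype.piFinset (Function.update (fun _ => T) k S)

lemma mem_tripleBox {k : Fin 3} {S T : Finset α} {e : Fin 3 → α} :
    e ∈ tripleBox k S T ↔ e k ∈ S ∧ ∀ l, l ≠ k → e l ∈ T := by
  rw [tripleBox, Fintype.mem_piFinset]
  constructor
  · intro h
    exact ⟨by simpa using h k, fun l hl => by simpa [hl] using h l⟩
  · rintro ⟨h1, h2⟩ l
    by_cases hl : l = k
    · subst hl; simpa using h1
    · simpa [hl] using h2 l hl

lemma forall_mem_of_mem_tripleBox {P : Finset α} {e : Fin 3 → α} (he : e ∈ tripleBox 0 P P)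
    (k : Fin 3) : e k ∈ P := by
  rw [mem_tripleBox] at he
  by_cases hk : k = 0
  · exact hk ▸ he.1
  · exact he.2 k hk

lemma card_tripleBox (k : Fin 3) (S T : Finset α) :
    (tripleBox k S T).card = S.card * T.card ^ 2 := by
  rw [tripleBox, Fintype.card_piFinset, Fin.prod_univ_three]
  fin_cases k <;> simp <;> ring

/-- The union of `X`, the `W k` and the `Y k`. In all uses there is a set `P` of vertices such that
the triples in `X` have all coordinates in `P`, those in `W k` all but the one with index `k`, and
those in `Y k` only the one with index `k`. -/
def layers [DecidableEq α] (X : Finset (Fin 3 → α)) (W Y : Fin 3 → Finset (Fin 3 → α)) :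
    Finset (Fin 3 → α) :=
  X ∪ Finset.univ.biUnion W ∪ Finset.univ.biUnion Y

lemma mem_layers [DecidableEq α] {X : Finset (Fin 3 → α)} {W Y : Fin 3 → Finset (Fin 3 → α)}
    {e : Fin 3 → α} :
    e ∈ layers X W Y ↔ e ∈ X ∨ (∃ k, e ∈ W k) ∨ ∃ k, e ∈ Y k := by
  simp [layers]

lemma card_layers_le [DecidableEq α] {X : Finset (Fin 3 → α)}
    {W Y : Fin 3 → Finset (Fin 3 → α)} {w y : ℕ}
    (hw : ∀ k, (W k).card = w) (hy : ∀ k, (Y k).card = y) :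
    (layers X W Y).card ≤ X.card + 3 * w + 3 * y := by
  have h1 : (Finset.univ.biUnion W).card ≤ 3 * w :=
    (Finset.card_biUnion_le).trans (by simp [hw])
  have h2 : (Finset.univ.biUnion Y).card ≤ 3 * y :=
    (Finset.card_biUnion_le).trans (by simp [hy])
  have h3 := Finset.card_union_le (X ∪ Finset.univ.biUnion W) (Finset.univ.biUnion Y)
  have h4 := Finset.card_union_le X (Finset.univ.biUnion W)
  rw [layers]
  omega

lemma le_card_filter_layers [Fintype α] [DecidableEq α] {P : Finset α} {X : Finset (Fin 3 → α)}
    {W Y : Fin 3 → Finset (Fin 3 → α)} {w y : ℕ}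
    (hX : ∀ e ∈ X, ∀ k, e k ∈ P) (hW : ∀ k, W k ⊆ tripleBox k Pᶜ P)
    (hY : ∀ k, Y k ⊆ tripleBox k P Pᶜ)
    (hw : ∀ k, (W k).card = w) (hy : ∀ k, (Y k).card = y) (k : Fin 3) :
    X.card + 2 * w + y ≤ ((layers X W Y).filter fun e => e k ∈ P).card := by
  have hW' {l e} (he : e ∈ W l) := mem_tripleBox.1 (hW l he)
  have hY' {l e} (he : e ∈ Y l) := mem_tripleBox.1 (hY l he)
  have hdW : ((Finset.univ.erase k : Finset (Fin 3)) : Set (Fin 3)).PairwiseDisjoint W := by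
    intro l _ l' _ hll
    refine Finset.disjoint_left.2 fun e he he' => ?_
    exact (Finset.mem_compl.1 (hW' he).1) ((hW' he').2 l hll)
  have hd1 : Disjoint X ((Finset.univ.erase k).biUnion W) := by
    refine Finset.disjoint_left.2 fun e he he' => ?_
    obtain ⟨l, -, hl⟩ := Finset.mem_biUnion.1 he'
    exact (Finset.mem_compl.1 (hW' hl).1) (hX e he l)
  have hd2 : Disjoint (X ∪ (Finset.univ.erase k).biUnion W) (Y k) := by
    refine Finset.disjoint_left.2 fun e he he' => ?_
    have hout := fun l hl => Finset.mem_compl.1 ((hY' he').2 l hl)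
    rcases Finset.mem_union.1 he with h | h
    · exact hout (k + 1) (by simp) (hX e h _)
    · obtain ⟨l, hl, hl'⟩ := Finset.mem_biUnion.1 h
      obtain ⟨l'', h1, h2⟩ : ∃ l'' : Fin 3, l'' ≠ k ∧ l'' ≠ l :=
        (by decide : ∀ k l : Fin 3, ∃ l'' : Fin 3, l'' ≠ k ∧ l'' ≠ l) k l
      exact hout l'' h1 ((hW' hl').2 l'' h2)
  have hcard : (X ∪ (Finset.univ.erase k).biUnion W ∪ Y k).card = X.card + 2 * w + y := by
    rw [Finset.card_union_of_disjoint hd2, Finset.card_union_of_disjoint hd1,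
      Finset.card_biUnion hdW, hy]
    simp [hw]
  rw [← hcard]
  refine Finset.card_le_card fun e he => ?_
  simp only [Finset.mem_union, Finset.mem_biUnion, Finset.mem_erase] at he
  rw [Finset.mem_filter, mem_layers]
  rcases he with (h | ⟨l, hl, h⟩) | h
  · exact ⟨Or.inl h, hX e h k⟩
  · exact ⟨Or.inr (Or.inl ⟨l, h⟩), (hW' h).2 k hl.1.symm⟩
  · exact ⟨Or.inr (Or.inr ⟨k, h⟩), (hY' h).1⟩

/-- The layers over `P` with all triples having at least two coordinates in `P`, and with `Y k`
large enough to provide `P.card * hi` incidences with `P` in each class. -/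
lemma le_card_filter_full_layers [Fintype α] [DecidableEq α] {P : Finset α}
    {Y : Fin 3 → Finset (Fin 3 → α)} {r hi : ℕ}
    (hr : P.card + r = Fintype.card α) (hY : ∀ k, Y k ⊆ tripleBox k P Pᶜ)
    (hy : ∀ k, (Y k).card = P.card * hi - (P.card ^ 3 + 2 * (P.card ^ 2 * r))) (k : Fin 3) :
    P.card * hi ≤ ((layers (tripleBox 0 P P) (fun k => tripleBox k Pᶜ P) Y).filter
      fun e => e k ∈ P).card := by
  have hPc : Pᶜ.card = r := by rw [Finset.card_compl]; omega
  have h := le_card_filter_layers (P := P) (X := tripleBox 0 P P)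
    (W := fun k => tripleBox k Pᶜ P) (w := r * P.card ^ 2) (fun e => forall_mem_of_mem_tripleBox)
    (fun k => subset_rfl) hY (fun k => by rw [card_tripleBox, hPc]) hy k
  rw [card_tripleBox] at h
  refine le_trans ?_ h
  have h1 : P.card * P.card ^ 2 = P.card ^ 3 := by ring
  have h2 : r * P.card ^ 2 = P.card ^ 2 * r := by ring
  omega

/-! ### The inequalities between the sizes of the layers -/

/-- The family of all triples with at least two coordinates in a set of `p` vertices, supplemented so
as to have `p * hi` incidences in each class, is not too large. Here `r ≥ p` is the number of the
other vertices. After division by `(p + r) ^ 3` the inequality is cubic in `x = p / (p + r)`, and the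
constants `2 / 7` and `5 / 7` make it nearly sharp around `x = 1 / 3`. -/
lemma card_full_layers_bound {p r hi lo : ℕ} (hpr : p ≤ r) (hhi : 7 * hi ≤ 5 * (p + r) ^ 2)
    (hlo : lo + hi = (p + r) ^ 2) :
    p ^ 3 + 3 * (r * p ^ 2) + 3 * (p * hi - (p ^ 3 + 2 * (p ^ 2 * r))) ≤ p * hi + r * lo := by
  rcases le_total (p * hi) (p ^ 3 + 2 * (p ^ 2 * r)) with h | h
  · rw [Nat.sub_eq_zero_of_le h]
    zify at *
    have hlo' : (lo : ℤ) = (p + r) ^ 2 - hi := by linarith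
    rw [hlo']
    have h1 : (0 : ℤ) ≤ (r - p) * (5 * (p + r) ^ 2 - 7 * hi) :=
      mul_nonneg (by linarith) (by linarith)
    have h2 : (0 : ℤ) ≤ (r - p) * (2 * r ^ 2 + 11 * r * p + 2 * p ^ 2) :=
      mul_nonneg (by linarith) (by positivity)
    nlinarith
  · zify [h] at *
    have hlo' : (lo : ℤ) = (p + r) ^ 2 - hi := by linarith
    rw [hlo']
    have h1 : (0 : ℤ) ≤ (2 * p + r) * (5 * (p + r) ^ 2 - 7 * hi) :=
      mul_nonneg (by positivity) (by linarith)
    -- `4 x³ + 3 x² - 6 x + 2 > 0` for `x ≥ 0`, with minimum `1 / 4` at `x = 1 / 2`.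
    have h2 : (0 : ℤ) ≤ (4 * p + 7 * r) * (2 * p - r) ^ 2 + r ^ 3 := by positivity
    nlinarith

/-- The family of all triples within a set of `q` vertices and `3 * z` triples with exactly two
coordinates there is not too large. Here `m ≤ q` is the number of the other vertices, and `2 * z` is
the number of missing incidences in each class, rounded up to an even number. -/
lemma card_two_layers_bound {m q z hi lo : ℕ} (hmq : m ≤ q) (hm : 1 ≤ m)
    (hhi : 7 * hi ≤ 5 * (q + m) ^ 2) (hlo : lo + hi = (q + m) ^ 2) (hq : q ^ 2 ≤ hi)
    (hz : 2 * z ≤ q * hi - q ^ 3 + 1) :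
    q ^ 3 + 3 * z ≤ q * hi + m * lo := by
  have hqq : q ^ 3 ≤ q * hi := by
    calc q ^ 3 = q * q ^ 2 := by ring
      _ ≤ q * hi := Nat.mul_le_mul_left _ hq
  by_cases hbig : 21 + 6 * q ^ 2 * m ≤ 2 * q ^ 3 + 3 * q * m ^ 2 + 4 * m ^ 3
  · zify [hqq] at *
    have hlo' : (lo : ℤ) = (q + m) ^ 2 - hi := by linarith
    rw [hlo']
    have h1 : (0 : ℤ) ≤ (q + 2 * m) * (5 * (q + m) ^ 2 - 7 * hi) :=
      mul_nonneg (by positivity) (by linarith)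
    nlinarith
  -- The cubic form `2 q³ - 6 q² m + 3 q m² + 4 m³` is positive, but too small to absorb the
  -- rounding error in `z` for five pairs `(m, q)`.
  have hm3 : m < 3 := by
    by_contra! hm3
    apply hbig
    zify at *
    have h1 : (0 : ℤ) ≤ (14 * q + 6 * m) * (7 * q - 12 * m) ^ 2 := by positivity
    have h2 : (27 : ℤ) ≤ m ^ 3 := by
      have := pow_le_pow_left₀ (by norm_num : (0 : ℤ) ≤ 3) hm3 3
      linarith
    have h3 : (0 : ℤ) ≤ q * m ^ 2 := by positivity
    nlinarith
  have hq5 : q < 5 := by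
    by_contra! hq5
    apply hbig
    obtain ⟨s, rfl⟩ := Nat.exists_eq_add_of_le hq5
    interval_cases m <;> ring_nf <;> nlinarith [sq_nonneg s]
  interval_cases m <;> interval_cases q <;> omega

/-- Among the triples with exactly two coordinates in a set of `q` vertices, each layer is large enough
to contain `z` triples. -/
lemma card_two_layers_le_box {m q z hi : ℕ} (hmq : m ≤ q)
    (hhi : 7 * hi ≤ 5 * (q + m) ^ 2) (hz : 2 * z ≤ q * hi - q ^ 3 + 1) :
    z ≤ m * q ^ 2 := by
  have h : q * hi ≤ q ^ 3 + 2 * (m * q ^ 2) := by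
    have h1 : hi ≤ q ^ 2 + 2 * (m * q) := by nlinarith
    calc q * hi ≤ q * (q ^ 2 + 2 * (m * q)) := Nat.mul_le_mul_left _ h1
      _ = _ := by ring
  omega

/-- Among the triples with exactly one coordinate in a set of `p` vertices, each layer is large enough
to make up for the incidences which the triples with at least two coordinates do not provide. -/
lemma card_one_layers_le_box {p r hi : ℕ} (hhi : hi ≤ (p + r) ^ 2) :
    p * hi - (p ^ 3 + 2 * (p ^ 2 * r)) ≤ p * r ^ 2 := by
  have : p * hi ≤ p * (p + r) ^ 2 := Nat.mul_le_mul_left _ hhi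
  rw [Nat.sub_le_iff_le_add]
  nlinarith

/-- Two layers that compete for the triples with one coordinate in a set of `p` vertices and two in a
set of `q` vertices fit side by side. The right-hand side is the size of their union. -/
lemma card_add_layers_le {p q z hi : ℕ} (hpq : p < q)
    (hhi : 7 * hi ≤ 5 * (p + q + 1) ^ 2) (hq : q ^ 2 ≤ hi)
    (hz : 2 * z ≤ q * hi - q ^ 3 + 1) :
    p * hi - (p ^ 3 + 2 * (p ^ 2 * (q + 1))) + z ≤ p * (q + 1) ^ 2 + q ^ 2 := by
  have hqq : q ^ 3 ≤ q * hi := by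
    calc q ^ 3 = q * q ^ 2 := by ring
      _ ≤ q * hi := Nat.mul_le_mul_left _ hq
  rcases le_or_gt (p * hi) (p ^ 3 + 2 * (p ^ 2 * (q + 1))) with h | h
  · rw [Nat.sub_eq_zero_of_le h]
    have := card_two_layers_le_box (m := p + 1) hpq (by convert hhi using 3; ring) hz
    nlinarith
  · have hp : 1 ≤ p := by
      rcases Nat.eq_zero_or_pos p with rfl | hp
      · simp at h
      · exact hp
    have hz' := h.le
    zify [hqq, hz'] at *
    have h1 : (0 : ℤ) ≤ (2 * p + q) * (5 * (p + q + 1) ^ 2 - 7 * hi) :=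
      mul_nonneg (by positivity) (by linarith)
    have h2 : (0 : ℤ) ≤ (4 * p + 7 * q) * (2 * p - q) ^ 2 := by positivity
    have h3 : (0 : ℤ) ≤ q ^ 3 + 32 * p ^ 2 - 8 * p * q + 16 * q ^ 2 + 16 * p - 20 * q - 28 := by
      have hq2 : (2 : ℤ) ≤ q := by linarith
      have h4 : (8 : ℤ) ≤ q ^ 3 := by
        have := pow_le_pow_left₀ (by norm_num : (0 : ℤ) ≤ 2) hq2 3
        linarith
      nlinarith [sq_nonneg (4 * (p : ℤ) - q)]
    nlinarith

/-- When `p` vertices face `p` others across a single vertex, the supplement needed fits into the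
`p * (p + 1)` triples having, in three given classes, one of the `p` vertices, the single vertex,
and any vertex not among the `p` ones. -/
lemma card_one_layers_le_of_balanced {p hi : ℕ} (hhi : 7 * hi ≤ 5 * (2 * p + 1) ^ 2) :
    p * hi - (p ^ 3 + 2 * (p ^ 2 * (p + 1))) ≤ p * (p + 1) := by
  have h1 : hi ≤ 3 * p ^ 2 + 3 * p + 1 := by nlinarith
  have : p * hi ≤ p * (3 * p ^ 2 + 3 * p + 1) := Nat.mul_le_mul_left _ h1
  rw [Nat.sub_le_iff_le_add]
  nlinarith

end Layers

/-! ### Two disjoint families of triples -/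

section Families

variable {α : Type*}

lemma exists_disjoint_subsets_card_eq [DecidableEq α] {U V : Finset α} {y z : ℕ}
    (hy : y ≤ U.card) (hz : z ≤ V.card) (hyz : y + z ≤ (U ∪ V).card) :
    ∃ Y ⊆ U, ∃ Z ⊆ V, Disjoint Y Z ∧ Y.card = y ∧ Z.card = z := by
  have hUV := Finset.card_sdiff_add_card U V
  -- `Y` uses the points outside `V` first.
  rcases le_total y (U \ V).card with h | h
  · obtain ⟨Y, hY, hYc⟩ := Finset.exists_subset_card_eq h
    obtain ⟨Z, hZ, hZc⟩ := Finset.exists_subset_card_eq hz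
    refine ⟨Y, hY.trans Finset.sdiff_subset, Z, hZ, ?_, hYc, hZc⟩
    exact Finset.disjoint_left.2 fun x hx hx' => (Finset.mem_sdiff.1 (hY hx)).2 (hZ hx')
  · obtain ⟨Y, hY, hYU, hYc⟩ := Finset.exists_subsuperset_card_eq
      (Finset.sdiff_subset : U \ V ⊆ U) h hy
    have hVY : z ≤ (V \ Y).card := by
      have h1 : U ∪ V ⊆ (V \ Y) ∪ Y := by
        intro x hx
        by_cases hxY : x ∈ Y
        · simp [hxY]
        · have : x ∈ V := by
            by_contra hxV
            exact hxY (hY (Finset.mem_sdiff.2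
              ⟨(Finset.mem_union.1 hx).resolve_right hxV, hxV⟩))
          simp [hxY, this]
      have h2 := (Finset.card_le_card h1).trans (Finset.card_union_le _ _)
      omega
    obtain ⟨Z, hZ, hZc⟩ := Finset.exists_subset_card_eq hVY
    refine ⟨Y, hYU, Z, hZ.trans Finset.sdiff_subset, ?_, hYc, hZc⟩
    exact Finset.disjoint_left.2 fun x hx hx' => (Finset.mem_sdiff.1 (hZ hx')).2 hx

lemma not_two_coords_and_two_coords {P Q : Finset α} (hPQ : Disjoint P Q) {e : Fin 3 → α}
    {k k' : Fin 3} (h : ∀ l, l ≠ k → e l ∈ P) (h' : ∀ l, l ≠ k' → e l ∈ Q) : False := by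
  obtain ⟨l, h1, h2⟩ : ∃ l : Fin 3, l ≠ k ∧ l ≠ k' :=
    (by decide : ∀ k k' : Fin 3, ∃ l : Fin 3, l ≠ k ∧ l ≠ k') k k'
  exact Finset.disjoint_left.1 hPQ (h l h1) (h' l h2)

variable [Fintype α] [DecidableEq α]

/-- A family of triples rich in `P`: it has at least `P.card * hi` incidences with `P` in each
class, and no more triples than a degree sequence with the value `hi` on `P` and the value `lo`
elsewhere requires. -/
def IsRich (P : Finset α) (hi lo : ℕ) (A : Finset (Fin 3 → α)) : Prop :=
  (∀ k, P.card * hi ≤ (A.filter fun e => e k ∈ P).card) ∧ A.card ≤ P.card * hi + Pᶜ.card * lo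

lemma isRich_full_layers {P : Finset α} {Y : Fin 3 → Finset (Fin 3 → α)} {hi lo : ℕ}
    (hP : P.card ≤ Pᶜ.card) (hhi : 7 * hi ≤ 5 * Fintype.card α ^ 2)
    (hlo : lo + hi = Fintype.card α ^ 2) (hY : ∀ k, Y k ⊆ tripleBox k P Pᶜ)
    (hy : ∀ k, (Y k).card = P.card * hi - (P.card ^ 3 + 2 * (P.card ^ 2 * Pᶜ.card))) :
    IsRich P hi lo (layers (tripleBox 0 P P) (fun k => tripleBox k Pᶜ P) Y) := by
  have hc := Finset.card_add_card_compl P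
  refine ⟨le_card_filter_full_layers hc hY hy, ?_⟩
  rw [← hc] at hhi hlo
  have h := card_layers_le (X := tripleBox 0 P P) (W := fun k => tripleBox k Pᶜ P) (Y := Y)
    (fun k => card_tripleBox k Pᶜ P) hy
  rw [card_tripleBox] at h
  refine h.trans (le_trans (le_of_eq ?_) (card_full_layers_bound hP hhi hlo))
  ring

lemma exists_two_coords_or_mem_of_mem_layers {P : Finset α} {X : Finset (Fin 3 → α)}
    {W Y : Fin 3 → Finset (Fin 3 → α)} (hX : ∀ e ∈ X, ∀ k, e k ∈ P)
    (hW : ∀ k, W k ⊆ tripleBox k Pᶜ P) {e : Fin 3 → α} (he : e ∈ layers X W Y) :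
    (∃ k, ∀ l, l ≠ k → e l ∈ P) ∨ ∃ k, e ∈ Y k := by
  rcases mem_layers.1 he with h | ⟨k, h⟩ | h
  · exact Or.inl ⟨0, fun l _ => hX e h l⟩
  · exact Or.inl ⟨k, (mem_tripleBox.1 (hW k h)).2⟩
  · exact Or.inr h

/-- For sets `P` and `Q` of equal size missing one vertex, the two families contain all triples with
at least two coordinates in `P`, respectively `Q`. The remaining triples are taken with the
missing vertex following the coordinate in `P`, respectively `Q`, in the cyclic order of the
classes, which keeps the two families disjoint. -/
lemma exists_disjoint_isRich_of_card_eq {P Q : Finset α} {hi lo : ℕ} (hPQ : Disjoint P Q)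
    (hcard : P.card + Q.card + 1 = Fintype.card α) (hpq : P.card = Q.card)
    (hhi : 7 * hi ≤ 5 * Fintype.card α ^ 2) (hlo : lo + hi = Fintype.card α ^ 2) :
    ∃ A C : Finset (Fin 3 → α), Disjoint A C ∧ IsRich P hi lo A ∧ IsRich Q hi lo C := by
  have hM : (P ∪ Q)ᶜ.card = 1 := by
    rw [Finset.card_compl, Finset.card_union_of_disjoint hPQ]; omega
  have hM' : (Pᶜ ∩ Qᶜ).card = 1 := by rwa [← Finset.compl_union]
  have key (R : Finset α) (hRPQ : R ⊆ P ∪ Q) (hR : R.card = P.card) :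
      ∃ Y : Fin 3 → Finset (Fin 3 → α), (∀ k, Y k ⊆ tripleBox k R Rᶜ) ∧
        (∀ k, ∀ e ∈ Y k, e (k + 1) ∈ (P ∪ Q)ᶜ) ∧
        ∀ k, (Y k).card = R.card * hi - (R.card ^ 3 + 2 * (R.card ^ 2 * Rᶜ.card)) := by
    have hRc : Rᶜ.card = R.card + 1 := by rw [Finset.card_compl]; omega
    have hex (k : Fin 3) : ∃ Y ⊆ Fintype.piFinset
        (fun l => if l = k then R else if l = k + 1 then (P ∪ Q)ᶜ else Rᶜ),
        Y.card = R.card * hi - (R.card ^ 3 + 2 * (R.card ^ 2 * Rᶜ.card)) := by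
      refine Finset.exists_subset_card_eq ?_
      have h : (Fintype.piFinset
          (fun l => if l = k then R else if l = k + 1 then (P ∪ Q)ᶜ else Rᶜ)).card =
          R.card * (R.card + 1) := by
        rw [Fintype.card_piFinset, Fin.prod_univ_three]
        fin_cases k <;> simp [hM', hRc, mul_comm]
      rw [h, hRc]
      refine card_one_layers_le_of_balanced (hhi.trans (le_of_eq ?_))
      rw [← hcard, ← hpq, hR]
      ring
    choose Y hY hYc using hex
    refine ⟨Y, fun k e he => ?_, fun k e he => ?_, hYc⟩
    · have := Fintype.mem_piFinset.1 (hY k he)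
      refine mem_tripleBox.2 ⟨by simpa using this k, fun l hl => ?_⟩
      have hl' := this l
      rw [if_neg hl] at hl'
      split_ifs at hl' with h
      · exact Finset.compl_subset_compl.2 hRPQ hl'
      · exact hl'
    · have := Fintype.mem_piFinset.1 (hY k he) (k + 1)
      simpa using this
  obtain ⟨Y, hY, hYM, hYc⟩ := key P Finset.subset_union_left rfl
  obtain ⟨Z, hZ, hZM, hZc⟩ := key Q Finset.subset_union_right hpq.symm
  have hPc := Finset.card_add_card_compl P
  have hQc := Finset.card_add_card_compl Q
  refine ⟨_, _, ?_, isRich_full_layers (by omega) hhi hlo hY hYc,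
    isRich_full_layers (by omega) hhi hlo hZ hZc⟩
  have hYP {k e} (h : e ∈ Y k) : e k ∈ P := (mem_tripleBox.1 (hY k h)).1
  have hZQ {k e} (h : e ∈ Z k) : e k ∈ Q := (mem_tripleBox.1 (hZ k h)).1
  have hYM' {k e} (h : e ∈ Y k) : e (k + 1) ∉ P ∧ e (k + 1) ∉ Q := by simpa using hYM k e h
  have hZM' {k e} (h : e ∈ Z k) : e (k + 1) ∉ P ∧ e (k + 1) ∉ Q := by simpa using hZM k e h
  have hd {x : α} (h1 : x ∈ P) (h2 : x ∈ Q) : False := Finset.disjoint_left.1 hPQ h1 h2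
  refine Finset.disjoint_left.2 fun e he he' => ?_
  rcases exists_two_coords_or_mem_of_mem_layers (fun e => forall_mem_of_mem_tripleBox)
      (fun k => subset_rfl) he with ⟨k, hk⟩ | ⟨k, hk⟩ <;>
    rcases exists_two_coords_or_mem_of_mem_layers (fun e => forall_mem_of_mem_tripleBox)
      (fun k => subset_rfl) he' with ⟨k', hk'⟩ | ⟨k', hk'⟩
  · exact not_two_coords_and_two_coords hPQ hk hk'
  · by_cases h : k' = k
    · exact (hZM' hk').1 (hk _ (by simp [h]))
    · exact hd (hk k' h) (hZQ hk')
  · by_cases h : k = k'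
    · exact (hYM' hk).2 (hk' _ (by simp [h]))
    · exact hd (hYP hk) (hk' k h)
  · rcases (by decide : ∀ k k' : Fin 3, k' = k ∨ k' = k + 1 ∨ k = k' + 1) k k' with rfl | rfl | rfl
    · exact hd (hYP hk) (hZQ hk')
    · exact (hYM' hk).2 (hZQ hk')
    · exact (hZM' hk').1 (hYP hk)

/-- For `P` smaller than `Q`, the family rich in `P` contains all triples with at least two
coordinates in `P`. The family rich in `Q` consists of triples with at least two coordinates in
`Q`; the triples with one coordinate in `P` and two in `Q` have to be shared. -/
lemma exists_disjoint_isRich_of_card_lt {P Q : Finset α} {hi lo : ℕ} (hPQ : Disjoint P Q)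
    (hcard : P.card + Q.card + 1 = Fintype.card α) (hpq : P.card < Q.card)
    (hhi : 7 * hi ≤ 5 * Fintype.card α ^ 2) (hlo : lo + hi = Fintype.card α ^ 2) :
    ∃ A C : Finset (Fin 3 → α), Disjoint A C ∧ IsRich P hi lo A ∧ IsRich Q hi lo C := by
  have hPc : Pᶜ.card = Q.card + 1 := by rw [Finset.card_compl]; omega
  have hQc : Qᶜ.card = P.card + 1 := by rw [Finset.card_compl]; omega
  have hhi' : hi ≤ (P.card + (Q.card + 1)) ^ 2 := by
    rw [show P.card + (Q.card + 1) = Fintype.card α by omega]; omega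
  have hhi2 : 7 * hi ≤ 5 * (Q.card + (P.card + 1)) ^ 2 := by
    rwa [show Q.card + (P.card + 1) = Fintype.card α by omega]
  have hlo2 : lo + hi = (Q.card + (P.card + 1)) ^ 2 := by
    rwa [show Q.card + (P.card + 1) = Fintype.card α by omega]
  have hd {x : α} (h1 : x ∈ P) (h2 : x ∈ Q) : False := Finset.disjoint_left.1 hPQ h1 h2
  set y := P.card * hi - (P.card ^ 3 + 2 * (P.card ^ 2 * Pᶜ.card)) with hy
  have hybox (k : Fin 3) : y ≤ (tripleBox k P Pᶜ).card := by
    rw [card_tripleBox, hy, hPc]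
    exact card_one_layers_le_box hhi'
  -- The family rich in `Q` consists of `X` and of the sets `Z k`.
  suffices h : ∃ (X : Finset (Fin 3 → α)) (Y Z : Fin 3 → Finset (Fin 3 → α)) (z : ℕ),
      (∀ e ∈ X, ∀ k, e k ∈ Q) ∧ (∀ k, Y k ⊆ tripleBox k P Pᶜ) ∧ (∀ k, Z k ⊆ tripleBox k Qᶜ Q) ∧
      (∀ k, Disjoint (Y k) (Z k)) ∧ (∀ k, (Y k).card = y) ∧ (∀ k, (Z k).card = z) ∧
      Q.card * hi ≤ X.card + 2 * z ∧ X.card + 3 * z ≤ Q.card * hi + Qᶜ.card * lo by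
    obtain ⟨X, Y, Z, z, hX, hY, hZ, hYZ, hYc, hZc, h1, h2⟩ := h
    refine ⟨_, layers X Z (fun _ => ∅), ?_, isRich_full_layers (by omega) hhi hlo hY hYc,
      fun k => ?_, ?_⟩
    · refine Finset.disjoint_left.2 fun e he he' => ?_
      rcases exists_two_coords_or_mem_of_mem_layers (fun e => forall_mem_of_mem_tripleBox)
          (fun k => subset_rfl) he with ⟨k, hk⟩ | ⟨k, hk⟩
      · rcases exists_two_coords_or_mem_of_mem_layers hX hZ he' with ⟨k', hk'⟩ | ⟨k', hk'⟩
        · exact not_two_coords_and_two_coords hPQ hk hk'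
        · simp at hk'
      · have hkP := (mem_tripleBox.1 (hY k hk)).1
        rcases mem_layers.1 he' with h | ⟨l, h⟩ | ⟨l, h⟩
        · exact hd hkP (hX e h k)
        · by_cases hlk : l = k
          · subst hlk
            exact Finset.disjoint_left.1 (hYZ l) hk h
          · exact hd hkP ((mem_tripleBox.1 (hZ l h)).2 k (Ne.symm hlk))
        · simp at h
    · have := le_card_filter_layers (P := Q) (Y := fun _ => ∅) hX hZ (by simp) hZc
        (fun _ => Finset.card_empty) k
      omega
    · have := card_layers_le (X := X) (Y := fun _ => ∅) hZc (fun _ => Finset.card_empty)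
      omega
  have hcube : (tripleBox 0 Q Q).card = Q.card ^ 3 := by rw [card_tripleBox]; ring
  rcases le_or_gt hi (Q.card ^ 2) with hq | hq
  · -- Triples within `Q` suffice.
    obtain ⟨X, hX, hXc⟩ : ∃ X ⊆ tripleBox 0 Q Q, X.card = Q.card * hi := by
      refine Finset.exists_subset_card_eq ?_
      calc Q.card * hi ≤ Q.card * Q.card ^ 2 := Nat.mul_le_mul_left _ hq
        _ = _ := by rw [hcube]; ring
    choose Y hY hYc using fun k => Finset.exists_subset_card_eq (hybox k)
    exact ⟨X, Y, fun _ => ∅, 0, fun e he => forall_mem_of_mem_tripleBox (hX he), hY, by simp,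
      by simp, hYc, by simp, by omega, by rw [hXc]; omega⟩
  · obtain ⟨z, hz1, hz2⟩ : ∃ z, Q.card * hi ≤ Q.card ^ 3 + 2 * z ∧
        2 * z ≤ Q.card * hi - Q.card ^ 3 + 1 :=
      ⟨(Q.card * hi - Q.card ^ 3 + 1) / 2, by omega, by omega⟩
    have hzbox (k : Fin 3) : z ≤ (tripleBox k Qᶜ Q).card := by
      rw [card_tripleBox, hQc]
      exact card_two_layers_le_box (by omega) hhi2 hz2
    have hyz (k : Fin 3) : y + z ≤ (tripleBox k P Pᶜ ∪ tripleBox k Qᶜ Q).card := by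
      have h1 := Finset.card_union_add_card_inter (tripleBox k P Pᶜ) (tripleBox k Qᶜ Q)
      have h2 : (tripleBox k P Pᶜ ∩ tripleBox k Qᶜ Q).card ≤ P.card * Q.card ^ 2 := by
        rw [← card_tripleBox k]
        refine Finset.card_le_card fun e he => ?_
        obtain ⟨h3, h4⟩ := Finset.mem_inter.1 he
        exact mem_tripleBox.2 ⟨(mem_tripleBox.1 h3).1, (mem_tripleBox.1 h4).2⟩
      have h3 := card_add_layers_le hpq (by rwa [hcard]) hq.le hz2
      rw [card_tripleBox, card_tripleBox, hQc, hPc, add_mul, one_mul] at h1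
      rw [hy, hPc]
      omega
    choose Y hY Z hZ hYZ hYc hZc using fun k =>
      exists_disjoint_subsets_card_eq (hybox k) (hzbox k) (hyz k)
    refine ⟨tripleBox 0 Q Q, Y, Z, z, fun e => forall_mem_of_mem_tripleBox, hY, hZ, hYZ, hYc, hZc,
      by omega, ?_⟩
    rw [hcube, hQc]
    exact card_two_layers_bound (by omega) (by omega) hhi2 hlo2 hq.le hz2

theorem exists_disjoint_isRich {P Q : Finset α} {hi lo : ℕ} (hPQ : Disjoint P Q)
    (hcard : P.card + Q.card + 1 = Fintype.card α)
    (hhi : 7 * hi ≤ 5 * Fintype.card α ^ 2) (hlo : lo + hi = Fintype.card α ^ 2) :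
    ∃ A C : Finset (Fin 3 → α), Disjoint A C ∧ IsRich P hi lo A ∧ IsRich Q hi lo C := by
  rcases lt_trichotomy P.card Q.card with h | h | h
  · exact exists_disjoint_isRich_of_card_lt hPQ hcard h hhi hlo
  · exact exists_disjoint_isRich_of_card_eq hPQ hcard h hhi hlo
  · obtain ⟨C, A, h1, h2, h3⟩ :=
      exists_disjoint_isRich_of_card_lt hPQ.symm (by omega) h hhi hlo
    exact ⟨A, C, h1.symm, h3, h2⟩

end Families

/-! ### Realization of degree sequences -/

/-- A quantity with `n * lo ≤ T ≤ n * hi` lies in one of the intervals cut out by the sums of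
sequences of length `n` with values in `{lo, hi}`. -/
lemma exists_split_of_le_of_le {n T hi lo : ℕ} (hn : 0 < n) (h1 : n * lo ≤ T) (h2 : T ≤ n * hi) :
    ∃ p q, p + q + 1 = n ∧ p * hi + (q + 1) * lo ≤ T ∧ T ≤ (p + 1) * hi + q * lo := by
  have hex : ∃ p, T ≤ (p + 1) * hi + (n - 1 - p) * lo :=
    ⟨n - 1, by rw [Nat.sub_add_cancel hn]; omega⟩
  have hmin : Nat.find hex ≤ n - 1 :=
    Nat.find_min' hex (by rw [Nat.sub_add_cancel hn]; omega)
  refine ⟨Nat.find hex, n - 1 - Nat.find hex, by omega, ?_, Nat.find_spec hex⟩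
  rcases hp : Nat.find hex with _ | p
  · rw [show n - 1 - 0 + 1 = n by omega]
    omega
  · have h3 := Nat.find_min hex (m := p) (by omega)
    rw [show n - 1 - (p + 1) + 1 = n - 1 - p by omega]
    omega

/-- Three sequences of equal sums, with values between `lo` and `hi`, are the degree sequences of a
set of triples. -/
theorem exists_coordDegree_eq_of_bounds {n hi lo : ℕ} (D : Fin 3 → Fin n → ℕ)
    (hsum : ∀ k l : Fin 3, ∑ i, D k i = ∑ i, D l i)
    (hhi : 7 * hi ≤ 5 * n ^ 2) (hlo : lo + hi = n ^ 2)
    (hDlo : ∀ k i, lo ≤ D k i) (hDhi : ∀ k i, D k i ≤ hi) :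
    ∃ E : Finset (Fin 3 → Fin n), ∀ k i, coordDegree E k i = D k i := by
  rcases Nat.eq_zero_or_pos n with rfl | hn
  · exact ⟨∅, fun k i => i.elim0⟩
  obtain ⟨p, q, hpqn, hp, hq⟩ := exists_split_of_le_of_le (T := ∑ i, D 0 i) hn
    (by simpa using Finset.card_nsmul_le_sum Finset.univ (D 0) lo fun i _ => hDlo 0 i)
    (by simpa using Finset.sum_le_card_nsmul Finset.univ (D 0) hi fun i _ => hDhi 0 i)
  obtain ⟨P, -, hP⟩ := Finset.exists_subset_card_eq
    (s := (Finset.univ : Finset (Fin n))) (n := p) (by simp; omega)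
  have hPc : Pᶜ.card = q + 1 := by rw [Finset.card_compl, Fintype.card_fin]; omega
  obtain ⟨Q, hQP, hQ⟩ := Finset.exists_subset_card_eq (s := Pᶜ) (n := q) (by omega)
  have hQc : Qᶜ.card = p + 1 := by rw [Finset.card_compl, Fintype.card_fin]; omega
  obtain ⟨A, C, hAC, ⟨hA, hAc⟩, hC, hCc⟩ := exists_disjoint_isRich (P := P) (Q := Q) (hi := hi)
    (lo := lo) (Finset.disjoint_left.2 fun x hx hx' => Finset.mem_compl.1 (hQP hx') hx)
    (by rw [Fintype.card_fin]; omega) (by rwa [Fintype.card_fin]) (by rwa [Fintype.card_fin])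
  have hall : Fintype.card (Fin 3 → Fin n) = n * n ^ 2 := by simp; ring
  have hCcompl := Finset.card_add_card_compl C
  have hslice (S : Finset (Fin n)) (k : Fin 3) :
      ((Finset.univ : Finset (Fin 3 → Fin n)).filter fun e => e k ∈ S).card = S.card * n ^ 2 := by
    rw [show (Finset.univ.filter fun e : Fin 3 → Fin n => e k ∈ S) = tripleBox k S Finset.univ by
      ext e; simp [mem_tripleBox], card_tripleBox]
    simp
  obtain ⟨E, hAE, hEC, hE⟩ := Finset.exists_subsuperset_card_eq (n := ∑ i, D 0 i)
    (s := A) (t := Cᶜ) (fun e he => Finset.mem_compl.2 (Finset.disjoint_left.1 hAC he))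
    (by rw [hP, hPc] at hAc; omega)
    (by
      rw [hQ, hQc] at hCc
      rw [hall, ← hlo] at hCcompl
      have : n * (lo + hi) = (p + 1) * hi + q * lo + (q * hi + (p + 1) * lo) := by
        rw [← hpqn]; ring
      omega)
  have hmaj (F : Finset (Fin 3 → Fin n)) (k : Fin 3) (hF : ∀ i, coordDegree F k i =
      coordDegree E k i) : ∑ i, D k i = ∑ i, coordDegree F k i ∧
      ∀ c, ∑ i, (D k i - c) ≤ ∑ i, (coordDegree F k i - c) := by
    simp only [hF]
    have hs : ∑ i, D k i = ∑ i, coordDegree E k i := by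
      rw [sum_univ_coordDegree, hE, hsum k 0]
    refine ⟨hs, sum_tsub_le_of_cuts (P := P) (Q := Q) (by rw [Fintype.card_fin]; omega) hs (hDlo k)
      (hDhi k) ?_ ?_⟩
    · rw [sum_coordDegree]
      exact (hA k).trans (Finset.card_le_card (Finset.filter_subset_filter _ hAE))
    · rw [sum_coordDegree]
      have h1 : Disjoint (E.filter fun e => e k ∈ Q) (C.filter fun e => e k ∈ Q) :=
        Finset.disjoint_filter_filter (Finset.disjoint_left.2 fun e he he' =>
          Finset.mem_compl.1 (hEC he) he')
      have h2 := Finset.card_le_card (Finset.union_subset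
        (Finset.filter_subset_filter (fun e => e k ∈ Q) (Finset.subset_univ E))
        (Finset.filter_subset_filter (fun e => e k ∈ Q) (Finset.subset_univ C)))
      rw [Finset.card_union_of_disjoint h1, hslice, ← hlo, mul_add] at h2
      have h3 := hC k
      omega
  -- Correcting the degrees in one class leaves the other two classes alone.
  obtain ⟨E₀, h₀, h₀'⟩ := exists_coordDegree_eq E 0 (D 0) (hmaj E 0 fun _ => rfl).1
    (hmaj E 0 fun _ => rfl).2
  have hmaj₁ := hmaj E₀ 1 (h₀' 1 (by decide))
  obtain ⟨E₁, h₁, h₁'⟩ := exists_coordDegree_eq E₀ 1 (D 1) hmaj₁.1 hmaj₁.2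
  have hmaj₂ := hmaj E₁ 2 fun i => (h₁' 2 (by decide) i).trans (h₀' 2 (by decide) i)
  obtain ⟨E₂, h₂, h₂'⟩ := exists_coordDegree_eq E₁ 2 (D 2) hmaj₂.1 hmaj₂.2
  refine ⟨E₂, fun k i => ?_⟩
  fin_cases k
  · exact ((h₂' 0 (by decide) i).trans (h₁' 0 (by decide) i)).trans (h₀ i)
  · exact (h₂' 1 (by decide) i).trans (h₁ i)
  · exact h₂ i

/-- A set of triples, each regarded as the set of its three vertices, is a tripartite hypergraph
with the same degrees. -/
lemma isTripartiteGraphic_coordDegree {n : ℕ} (E : Finset (Fin 3 → Fin n)) :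
    IsTripartiteGraphic (N := fun _ => n) fun k i => coordDegree E k i := by
  set edge : (Fin 3 → Fin n) → Set (TripartiteVertex fun _ => n) :=
    fun e => Set.range fun k => ⟨k, e k⟩ with hedge
  have hmem (e : Fin 3 → Fin n) (k : Fin 3) (i : Fin n) :
      (⟨k, i⟩ : TripartiteVertex fun _ => n) ∈ edge e ↔ e k = i := by
    simp only [hedge, Set.mem_range]
    constructor
    · rintro ⟨l, hl⟩
      obtain ⟨rfl, h⟩ := Sigma.mk.inj_iff.1 hl
      exact eq_of_heq h
    · rintro rfl
      exact ⟨k, rfl⟩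
  have hinj : Function.Injective edge := fun e e' h => funext fun k =>
    ((hmem e' k (e k)).1 (h ▸ (hmem e k (e k)).2 rfl)).symm
  refine ⟨⟨Set.univ, edge '' E, fun _ _ => Set.subset_univ _⟩, ⟨rfl, ?_⟩, fun k i => ?_⟩
  · rintro _ ⟨e, -, rfl⟩ k
    rw [Set.ncard_eq_one]
    refine ⟨⟨k, e k⟩, ?_⟩
    ext ⟨l, j⟩
    simp only [Set.mem_inter_iff, hmem, vertexClass, Set.mem_ofPred_eq, Set.mem_singleton_iff]
    constructor
    · rintro ⟨rfl, rfl⟩; rfl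
    · intro h
      obtain ⟨rfl, h⟩ := Sigma.mk.inj_iff.1 h
      exact ⟨(eq_of_heq h).symm, rfl⟩
  · have : {s | s ∈ edge '' (E : Set (Fin 3 → Fin n)) ∧
        (⟨k, i⟩ : TripartiteVertex fun _ => n) ∈ s} =
        edge '' ((E.filter fun e => e k = i : Finset (Fin 3 → Fin n)) : Set (Fin 3 → Fin n)) := by
      ext s
      simp only [Set.mem_ofPred_eq, Set.mem_image, Finset.mem_coe, Finset.mem_filter]
      constructor
      · rintro ⟨⟨e, he, rfl⟩, h⟩
        exact ⟨e, ⟨he, (hmem e k i).1 h⟩, rfl⟩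
      · rintro ⟨e, ⟨he, h⟩, rfl⟩
        exact ⟨⟨e, he, rfl⟩, (hmem e k i).2 h⟩
    rw [Hypergraph.degree, this, Set.ncard_image_of_injective _ hinj, Set.ncard_coe_finset]
    rfl

theorem mainTheorem2 (n : ℕ) (D : Fin 3 → Fin n → ℕ)
    (hsum : ∀ k l : Fin 3, ∑ i, D k i = ∑ i, D l i)
    (hlower : ∀ (k : Fin 3) (i : Fin n), 2 * (n : ℝ) ^ 2 / 7 ≤ (D k i : ℝ))
    (hupper : ∀ (k : Fin 3) (i : Fin n), (D k i : ℝ) ≤ 5 * (n : ℝ) ^ 2 / 7) :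
    IsTripartiteGraphic (N := fun _ => n) D := by
  have hlower' (k i) : 2 * n ^ 2 ≤ 7 * D k i := by
    have := hlower k i
    rw [div_le_iff₀ (by norm_num)] at this
    exact_mod_cast (by linarith : 2 * (n : ℝ) ^ 2 ≤ 7 * (D k i : ℝ))
  have hupper' (k i) : 7 * D k i ≤ 5 * n ^ 2 := by
    have := hupper k i
    rw [le_div_iff₀ (by norm_num)] at this
    exact_mod_cast (by linarith : 7 * (D k i : ℝ) ≤ 5 * (n : ℝ) ^ 2)
  obtain ⟨E, hE⟩ := exists_coordDegree_eq_of_bounds (hi := 5 * n ^ 2 / 7)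
    (lo := n ^ 2 - 5 * n ^ 2 / 7) D hsum (by omega) (by omega)
    (fun k i => by have := hlower' k i; omega) (fun k i => by have := hupper' k i; omega)
  obtain rfl : (fun k i => coordDegree E k i) = D := funext fun k => funext fun i => hE k i
  exact isTripartiteGraphic_coordDegree E
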